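/- All graphs are finite and simple. For positive integers $n,d$ with $n\ge 2d$, the circular complete graph $K_{n/d}$ has vertex set $\{0,1,\dots,n-1\}$, with $i,j$ adjacent if and only if $d\le |i-j|\le n-d$ (the pair $(n,d)$ need not be coprime). For a graph $G$, a vertex $v$ and an integer $i\ge 0$, let $N_i(v)$ be the set of vertices joined to $v$ by a walk of length exactly $i$. For a non-negative integer $r$, the dual power $G^{\frac{1}{\widetilde{2r+1}}}$ is the graph whose vertices are the tuples $(A_1,\dots,A_{r+1})$ of nonempty subsets of $V(G)$ such that $A_1=\{v\}$ is a singleton and $A_i\subseteq N_{i-1}(v)$ for all $1\le i\le r+1$; two vertices $(A_1,\dots,A_{r+1})$ and $(B_1,\dots,B_{r+1})$ are adjacent if and only if $A_i\subseteq B_{i+1}$ and $B_i\subseteq A_{i+1}$ for all $1\le i\le r$, and, for all $1\le j\le r+1$, every vertex of $A_j$ is adjacent in $G$ to every vertex of $B_j$. Two graphs $G,H$ are homomorphically equivalent, written $G\longleftrightarrow H$, if there are graph homomorphisms $G\to H$ and $H\to G$. **Lemma.** Let $n$ and $d$ be positive integers with $n>2d$, and let $r$ be a non-negative integer. If $\frac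 nd<4$, then $$K_{n/d}^{\frac{1}{\widetilde{2r+1}}}\longleftrightarrow K_{\frac{(2r+1)n}{rn+d}}.$$ -/

import Mathlib

/-- The circular complete graph `K_{n/d}`: vertices `0, …, n - 1`, with `i` and `j` adjacent
iff `d ≤ |i - j| ≤ n - d`. For `d ≥ 1` the clause `i ≠ j` is automatic. -/
def circularCompleteGraph (n d : ℕ) : SimpleGraph (Fin n) where
  Adj i j := i ≠ j ∧ (d : ℤ) ≤ |(i : ℤ) - (j : ℤ)| ∧ |(i : ℤ) - (j : ℤ)| ≤ (n : ℤ) - (d : ℤ)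
  symm := ⟨fun i j h => ⟨h.1.symm, by rw [abs_sub_comm]; exact h.2⟩⟩
  loopless := ⟨fun _ h => h.1 rfl⟩

/-- `N_i(v)`: the vertices joined to `v` by a walk of length exactly `i`. -/
def walkNeighborSet {V : Type*} (G : SimpleGraph V) (i : ℕ) (v : V) : Set V :=
  {u | ∃ p : G.Walk v u, p.length = i}

/-- `A ⋈ B`: every vertex of `A` is adjacent to every vertex of `B`. -/
def CompletelyJoined {V : Type*} (G : SimpleGraph V) (A B : Set V) : Prop :=
  ∀ a ∈ A, ∀ b ∈ B, G.Adj a b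

/-- Vertices of the dual root of order `2s + 1`: tuples `(A_1, …, A_{s+1})` of nonempty vertex
sets such that `A_1 = {v}` is a singleton and `A_i ⊆ N_{i-1}(v)`. The set `A_{i+1}` is
`sets i` for `i = 0, …, s`. -/
structure DualRootVertex {V : Type*} (G : SimpleGraph V) (s : ℕ) where
  sets : Fin (s + 1) → Set V
  nonempty : ∀ i, (sets i).Nonempty
  rooted : ∃ v, sets 0 = {v} ∧ ∀ i : Fin (s + 1), sets i ⊆ walkNeighborSet G (i : ℕ) v

/-- The dual root of `G` of order `2s + 1`, that is, the dual power with exponent `1/(2s+1)`: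
`(A_i)` and `(B_i)` are adjacent iff `A_i ⊆ B_{i+1}` and `B_i ⊆ A_{i+1}` for `1 ≤ i ≤ s`, and
`A_j ⋈ B_j` for `1 ≤ j ≤ s + 1`. -/
def dualRoot {V : Type*} (G : SimpleGraph V) (s : ℕ) : SimpleGraph (DualRootVertex G s) where
  Adj A B :=
    (∀ i : Fin s, A.sets i.castSucc ⊆ B.sets i.succ ∧ B.sets i.castSucc ⊆ A.sets i.succ) ∧
      ∀ j : Fin (s + 1), CompletelyJoined G (A.sets j) (B.sets j)
  symm := ⟨fun _ _ h =>
    ⟨fun i => (h.1 i).symm, fun j b hb a ha => (h.2 j a ha b hb).symm⟩⟩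
  loopless := ⟨fun A h => by
    obtain ⟨a, ha⟩ := A.nonempty 0
    exact G.loopless.irrefl a (h.2 0 a ha a ha)⟩

/-- Two graphs are homomorphically equivalent if each maps homomorphically to the other. -/
def HomEquivalent {V W : Type*} (G : SimpleGraph V) (H : SimpleGraph W) : Prop :=
  Nonempty (G →g H) ∧ Nonempty (H →g G)

/-! Both homomorphisms pass through colourings by `Fin n` that give adjacent colours in $K_{n/d}$ to
the ends of every odd walk of length at most $q = 2r+1$. Division by $q$ is such a colouring of
$K_{qn/(rn+d)}$, and the images of walk neighbourhoods then give a map into the dual root.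
Conversely, `root` is such a colouring of the dual root. Lift its differences along edges to $[d,
n-d]$. As $n < 4d$, walks of length $q$ have total lift at most $M = rn+n-d$, so the excess of $q$
times the lift over $M$ per edge is bounded on all walks. Its supremum is a potential correcting $q$
times the colour to a homomorphism into $K_{qn/(rn+d)}$. -/

/-! ### Displacements in circular complete graphs -/

theorem circularCompleteGraph_adj_of_dvd {n d : ℕ} (hd : 0 < d) {i j : Fin n} {t : ℤ}
    (h1 : (d : ℤ) ≤ t) (h2 : t ≤ n - d) (h : (n : ℤ) ∣ (j : ℤ) - i - t) :
    (circularCompleteGraph n d).Adj i j := by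
  obtain ⟨k, hk⟩ := h
  have hi := i.2
  have hj := j.2
  have k1 : k < 1 := by
    by_contra hc
    have : (n : ℤ) * 1 ≤ n * k := mul_le_mul_of_nonneg_left (by omega) (by omega)
    omega
  have k2 : -2 < k := by
    by_contra hc
    have : (n : ℤ) * k ≤ n * (-2) := mul_le_mul_of_nonneg_left (by omega) (by omega)
    omega
  have key : (d : ℤ) ≤ |(i : ℤ) - (j : ℤ)| ∧ |(i : ℤ) - (j : ℤ)| ≤ (n : ℤ) - (d : ℤ) := by
    have : k = 0 ∨ k = -1 := by omega
    rcases this with rfl | rfl <;>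
      rcases abs_cases ((i : ℤ) - (j : ℤ)) with ⟨h, _⟩ | ⟨h, _⟩ <;> rw [h] <;> omega
  refine ⟨?_, key⟩
  rintro rfl
  simp at key
  omega

theorem circularCompleteGraph_adj_emod {n d : ℕ} (hd : 0 < d) {i j : Fin n}
    (h : (circularCompleteGraph n d).Adj i j) :
    (d : ℤ) ≤ ((j : ℤ) - i) % n ∧ ((j : ℤ) - i) % n ≤ n - d := by
  obtain ⟨-, h1, h2⟩ := h
  have hi := i.2
  have hj := j.2
  rcases abs_cases ((i : ℤ) - (j : ℤ)) with ⟨h, _⟩ | ⟨h, _⟩ <;> rw [h] at h1 h2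
  · rw [← Int.add_emod_right, Int.emod_eq_of_lt (by omega) (by omega)]
    omega
  · rw [Int.emod_eq_of_lt (by omega) (by omega)]
    omega

theorem circularCompleteGraph_walk_displacement {n d : ℕ} (hd : 0 < d) {i j : Fin n}
    (p : (circularCompleteGraph n d).Walk i j) :
    ∃ s : ℤ, (p.length : ℤ) * d ≤ s ∧ s ≤ p.length * ((n : ℤ) - d) ∧
      (n : ℤ) ∣ (j : ℤ) - i - s := by
  induction p with
  | nil => exact ⟨0, by simp⟩
  | @cons u v w h p ih =>
    obtain ⟨s, h1, h2, h3⟩ := ih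
    obtain ⟨g1, g2⟩ := circularCompleteGraph_adj_emod hd h
    refine ⟨((v : ℤ) - u) % n + s, ?_, ?_, ?_⟩
    · simp only [SimpleGraph.Walk.length_cons]; push_cast; linarith
    · simp only [SimpleGraph.Walk.length_cons]; push_cast; linarith
    · have := dvd_add h3 (Int.dvd_self_sub_emod (x := (v : ℤ) - u) (m := n))
      refine this.trans (dvd_of_eq ?_)
      ring

theorem circularCompleteGraph_adj_div {n d q : ℕ} (hq : 0 < q) (hd : 0 < d) {x y : Fin (q * n)}
    {i j : Fin n} (h : (circularCompleteGraph (q * n) (q * d)).Adj x y)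
    (hi : (i : ℕ) = x / q) (hj : (j : ℕ) = y / q) : (circularCompleteGraph n d).Adj i j := by
  obtain ⟨-, g1, g2⟩ := h
  have hx := Nat.div_add_mod (x : ℕ) q
  have hy := Nat.div_add_mod (y : ℕ) q
  have hx' := Nat.mod_lt (x : ℕ) hq
  have hy' := Nat.mod_lt (y : ℕ) hq
  rw [← hi] at hx
  rw [← hj] at hy
  -- Remainders modulo `q` differ by less than `q`, so the rounding loses nothing.
  have mono : ∀ a b : ℤ, (q : ℤ) * a < q * b + q → a ≤ b := by
    intro a b h
    have : (q : ℤ) * a < q * (b + 1) := by linarith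
    have := lt_of_mul_lt_mul_left this (by positivity)
    omega
  zify at hx hy hx' hy'
  have hxp : (0 : ℤ) ≤ (x : ℤ) % q := Int.emod_nonneg _ (by omega)
  have hyp : (0 : ℤ) ≤ (y : ℤ) % q := Int.emod_nonneg _ (by omega)
  push_cast at g1 g2
  rcases abs_cases ((x : ℤ) - (y : ℤ)) with ⟨h, _⟩ | ⟨h, _⟩ <;> rw [h] at g1 g2
  · have a1 : (d : ℤ) ≤ i - j := mono _ _ (by linarith)
    have a2 : (i : ℤ) - j ≤ n - d := mono _ _ (by linarith)
    exact (circularCompleteGraph_adj_of_dvd hd a1 a2 (by simp)).symm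
  · have a1 : (d : ℤ) ≤ j - i := mono _ _ (by linarith)
    have a2 : (j : ℤ) - i ≤ n - d := mono _ _ (by linarith)
    exact circularCompleteGraph_adj_of_dvd hd a1 a2 (by simp)

/-- An odd walk of length at most `2r + 1` in `K_{(2r+1)n/(rn+d)}` joins vertices whose images
under division by `2r + 1` are adjacent in `K_{n/d}`. -/
theorem circularCompleteGraph_adj_div_of_walk {n d r k : ℕ} (hd : 0 < d) (hnd : 2 * d < n)
    (hk : k ≤ r) {x y : Fin ((2 * r + 1) * n)} {i j : Fin n}
    (p : (circularCompleteGraph ((2 * r + 1) * n) (r * n + d)).Walk x y)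
    (hp : p.length = 2 * k + 1) (hi : (i : ℕ) = x / (2 * r + 1))
    (hj : (j : ℕ) = y / (2 * r + 1)) :
    (circularCompleteGraph n d).Adj i j := by
  obtain ⟨s, h1, h2, h3⟩ := circularCompleteGraph_walk_displacement (by omega) p
  rw [hp] at h1 h2
  push_cast at h1 h2 h3
  obtain ⟨l, rfl⟩ := Nat.exists_eq_add_of_le hk
  -- After `k` full turns are removed, this is exactly the slack left in both bounds.
  have hl : (0 : ℤ) ≤ l * ((n : ℤ) - 2 * d) := mul_nonneg (by omega) (by omega)
  have hadj : (circularCompleteGraph ((2 * (k + l) + 1) * n) ((2 * (k + l) + 1) * d)).Adj x y := by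
    refine circularCompleteGraph_adj_of_dvd (by positivity) (t := s - k * ((2 * (k + l) + 1) * n))
      ?_ ?_ ?_
    · push_cast at h1 ⊢
      nlinarith
    · push_cast at h2 ⊢
      nlinarith
    · push_cast at h3 ⊢
      have := dvd_add h3 (Dvd.intro_left (k : ℤ) rfl : ((2 * (k + l) + 1) * n : ℤ) ∣ k * ((2 * (k + l) + 1) * n))
      refine this.trans (dvd_of_eq ?_)
      ring
  exact circularCompleteGraph_adj_div (by omega) hd hadj hi hj

/-! ### Colourings and the dual root -/

theorem walkNeighborSet_nonempty {V : Type*} {G : SimpleGraph V} (hG : ∀ v, ∃ w, G.Adj v w)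
    (i : ℕ) (v : V) : (walkNeighborSet G i v).Nonempty := by
  induction i generalizing v with
  | zero => exact ⟨v, .nil, rfl⟩
  | succ i ih =>
    obtain ⟨w, hw⟩ := hG v
    obtain ⟨u, p, hp⟩ := ih w
    exact ⟨u, .cons hw p, by simp [hp]⟩

/-- A colouring whose values at the ends of every odd walk of length at most `2r + 1` are
adjacent induces a homomorphism into the dual root. -/
theorem nonempty_hom_dualRoot {V W : Type*} {G : SimpleGraph V} {H : SimpleGraph W} {r : ℕ}
    (hG : ∀ v, ∃ w, G.Adj v w) (c : V → W)
    (hc : ∀ k ≤ r, ∀ u v (p : G.Walk u v), p.length = 2 * k + 1 → H.Adj (c u) (c v)) :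
    Nonempty (G →g dualRoot H r) := by
  let f : G →g H := ⟨c, fun {u v} h => hc 0 (Nat.zero_le _) u v (.cons h .nil) rfl⟩
  refine ⟨⟨fun x => ⟨fun i => c '' walkNeighborSet G i x,
    fun i => (walkNeighborSet_nonempty hG i x).image c, c x, ?_, ?_⟩, ?_⟩⟩
  · ext y
    constructor
    · rintro ⟨z, ⟨p, hp⟩, rfl⟩
      rw [SimpleGraph.Walk.eq_of_length_eq_zero hp]
      rfl
    · rintro rfl
      exact ⟨x, ⟨.nil, rfl⟩, rfl⟩
  · rintro i _ ⟨z, ⟨p, hp⟩, rfl⟩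
    exact ⟨p.map f, by simpa using hp⟩
  · intro x y hxy
    refine ⟨fun i => ⟨?_, ?_⟩, ?_⟩
    · rintro _ ⟨z, ⟨p, hp⟩, rfl⟩
      exact ⟨z, ⟨.cons hxy.symm p, by simpa using hp⟩, rfl⟩
    · rintro _ ⟨z, ⟨p, hp⟩, rfl⟩
      exact ⟨z, ⟨.cons hxy p, by simpa using hp⟩, rfl⟩
    · rintro j _ ⟨z, ⟨p, hp⟩, rfl⟩ _ ⟨z', ⟨p', hp'⟩, rfl⟩
      -- Back to `x`, across the edge, out from `y`: length `2 * j + 1`.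
      refine hc j (by omega) z z' (p.reverse.append (.cons hxy p')) ?_
      simp [hp, hp']
      omega

namespace DualRootVertex

variable {V : Type*} {G : SimpleGraph V} {r : ℕ}

/-- The vertex `v` with `A_1 = {v}`. -/
noncomputable def root (A : DualRootVertex G r) : V := A.rooted.choose

theorem sets_zero (A : DualRootVertex G r) : A.sets 0 = {A.root} := A.rooted.choose_spec.1

/-- Each edge of the walk pushes the root up one index, by the inclusions $A_i ⊆ B_{i+1}$. -/
theorem root_mem_of_walk {A B : DualRootVertex G r} (p : (dualRoot G r).Walk A B)
    (i : Fin (r + 1)) (hi : p.length = i) : A.root ∈ B.sets i := by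
  induction i using Fin.induction generalizing B with
  | zero =>
    cases SimpleGraph.Walk.eq_of_length_eq_zero hi
    rw [sets_zero]
    rfl
  | succ i ih =>
    have hp : ¬ p.Nil := by
      rw [← SimpleGraph.Walk.length_eq_zero_iff]
      simp [hi]
    refine ((p.adj_penultimate hp).1 i).1 (ih p.dropLast ?_)
    have := p.length_dropLast_add_one hp
    simp at hi ⊢
    omega

/-- Both roots reach index `k` at the ends of the middle edge, where the sets are completely joined.
-/
theorem root_adj_of_walk {A B : DualRootVertex G r} {k : ℕ} (hk : k ≤ r)
    (p : (dualRoot G r).Walk A B) (hp : p.length = 2 * k + 1) : G.Adj A.root B.root := by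
  have h : (dualRoot G r).Adj (p.getVert k) (p.getVert (k + 1)) :=
    p.adj_getVert_succ (by omega)
  refine h.2 ⟨k, by omega⟩ _ (root_mem_of_walk (p.take k) _ ?_) _
    (root_mem_of_walk (p.drop (k + 1)).reverse _ ?_)
  · simp [SimpleGraph.Walk.take_length]; omega
  · simp [SimpleGraph.Walk.drop_length]; omega

end DualRootVertex

/-! ### Weights of walks -/

namespace SimpleGraph.Walk

variable {V : Type*} {G : SimpleGraph V}

/-- The total weight of the darts of a walk. -/
def weight (w : V → V → ℤ) : {u v : V} → G.Walk u v → ℤ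
  | _, _, .nil => 0
  | _, _, @SimpleGraph.Walk.cons _ _ u v _ _ p => w u v + p.weight w

theorem exists_split_weight (w : V → V → ℤ) {u v : V} (p : G.Walk u v) (m l : ℕ)
    (h : p.length = m + l) : ∃ x, ∃ a : G.Walk u x, ∃ b : G.Walk x v,
      a.length = m ∧ b.length = l ∧ p.weight w = a.weight w + b.weight w := by
  induction p generalizing m with
  | nil =>
    simp only [length_nil] at h
    exact ⟨_, .nil, .nil, by simp; omega, by simp; omega, by simp [weight]⟩
  | cons e p ih =>
    cases m with
    | zero => exact ⟨_, .nil, .cons e p, rfl, by simpa using h, by simp [weight]⟩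
    | succ m =>
      simp only [length_cons] at h
      obtain ⟨x, a, b, h1, h2, h3⟩ := ih m (by omega)
      exact ⟨x, .cons e a, b, by simp [h1], h2, by simp [weight, h3, add_assoc]⟩

theorem weight_le (w : V → V → ℤ) {C : ℤ} (hw : ∀ u v, G.Adj u v → w u v ≤ C) {u v : V}
    (p : G.Walk u v) : p.weight w ≤ p.length * C := by
  induction p with
  | nil => simp [weight]
  | cons e p ih =>
    have := hw _ _ e
    simp only [weight, length_cons]
    push_cast
    linarith

theorem le_weight (w : V → V → ℤ) {C : ℤ} (hw : ∀ u v, G.Adj u v → C ≤ w u v) {u v : V}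
    (p : G.Walk u v) : p.length * C ≤ p.weight w := by
  induction p with
  | nil => simp [weight]
  | cons e p ih =>
    have := hw _ _ e
    simp only [weight, length_cons]
    push_cast
    linarith

/-- If walks of length `q` have weight at most `M`, then the mean excess `q * weight - M * length`
is bounded on all walks. -/
theorem weight_excess_le (w : V → V → ℤ) {C M : ℤ} {q : ℕ} (hq : 0 < q) (hC : 0 ≤ C) (hM : 0 ≤ M)
    (hw : ∀ u v, G.Adj u v → w u v ≤ C)
    (h : ∀ u v (p : G.Walk u v), p.length = q → p.weight w ≤ M) {u v : V} (p : G.Walk u v) :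
    q * p.weight w - p.length * M ≤ q * (q * C) := by
  induction hm : p.length using Nat.strong_induction_on generalizing u with
  | _ m ih =>
    rcases lt_or_ge m q with hlt | hle
    · have h1 := weight_le w hw p
      rw [hm] at h1
      have h2 : (m : ℤ) * C ≤ q * C := mul_le_mul_of_nonneg_right (by omega) hC
      have h3 : (q : ℤ) * p.weight w ≤ q * (q * C) :=
        mul_le_mul_of_nonneg_left (h1.trans h2) (by omega)
      have h4 : 0 ≤ (m : ℤ) * M := by positivity
      linarith
    -- The first `q` edges contribute no positive excess and can be cut off.
    · obtain ⟨l, rfl⟩ := Nat.exists_eq_add_of_le hle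
      obtain ⟨x, a, b, h1, h2, h3⟩ := exists_split_weight w p q l hm
      have h4 := ih l (by omega) b h2
      have h5 : (q : ℤ) * a.weight w ≤ q * M := mul_le_mul_of_nonneg_left (h _ _ a h1) (by omega)
      rw [h3]
      push_cast
      linarith

theorem dvd_sub_weight_emod (c : V → ℤ) (n : ℤ) {u v : V} (p : G.Walk u v) :
    n ∣ c v - c u - p.weight fun x y => (c y - c x) % n := by
  induction p with
  | nil => simp [weight]
  | @cons x y z e p ih =>
    have := dvd_add ih (Int.dvd_self_sub_emod (x := c y - c x) (m := n))
    refine this.trans (dvd_of_eq ?_)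
    simp only [weight]
    ring

end SimpleGraph.Walk

/-! ### The potential and the map to the circular complete graph -/

/-- The residue puts `s` in a translate of $[d, n-d]$ by a multiple of $n$. As $n < 4d$, the range
of `s` misses the translates by $kn$ and $(k+2)n$, leaving only the one between. -/
theorem dvd_squeeze {n d k s t : ℤ} (h4 : n < 4 * d) (hn : 0 < n) (h1 : k * n + 3 * d ≤ s)
    (h2 : s ≤ k * n + 3 * (n - d)) (ht1 : d ≤ t) (ht2 : t ≤ n - d) (h : n ∣ t - s) :
    (k + 1) * n + d ≤ s ∧ s ≤ (k + 1) * n + (n - d) := by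
  obtain ⟨l, hl⟩ := h
  have l1 : -l < k + 2 := by
    refine lt_of_mul_lt_mul_left ?_ hn.le
    linarith
  have l2 : k < -l := by
    refine lt_of_mul_lt_mul_left ?_ hn.le
    linarith
  obtain rfl : l = -(k + 1) := by omega
  constructor <;> linarith

/-- If the ends of every odd walk of length at most `2r + 1` get adjacent colours in `K_{n/d}`,
then lifting the colour differences to `[d, n - d]` gives walks of length `2k + 1 ≤ 2r + 1` total
difference in `[kn + d, kn + n - d]`. -/
theorem weight_mem_of_odd_walk {V : Type*} {G : SimpleGraph V} {n d r : ℕ} (hd : 0 < d)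
    (hn : 0 < n) (h4 : n < 4 * d) (c : V → Fin n)
    (hc : ∀ k ≤ r, ∀ u v (p : G.Walk u v), p.length = 2 * k + 1 →
      (circularCompleteGraph n d).Adj (c u) (c v)) {k : ℕ} (hk : k ≤ r) {u v : V}
    (p : G.Walk u v) (hp : p.length = 2 * k + 1) :
    (k : ℤ) * n + d ≤ p.weight (fun x y => ((c y : ℤ) - c x) % n) ∧
      p.weight (fun x y => ((c y : ℤ) - c x) % n) ≤ k * n + (n - d) := by
  set w : V → V → ℤ := fun x y => ((c y : ℤ) - c x) % n with hw
  have hadj : ∀ x y, G.Adj x y → (d : ℤ) ≤ w x y ∧ w x y ≤ n - d := fun x y h =>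
    circularCompleteGraph_adj_emod hd (hc 0 (Nat.zero_le _) x y (.cons h .nil) rfl)
  induction k generalizing u with
  | zero =>
    have h1 := p.weight_le w fun x y h => (hadj x y h).2
    have h2 := p.le_weight w fun x y h => (hadj x y h).1
    rw [hp] at h1 h2
    push_cast at h1 h2 ⊢
    constructor <;> linarith
  | succ k ih =>
    obtain ⟨x, a, b, ha, hb, hab⟩ := p.exists_split_weight w 2 (2 * k + 1) (by omega)
    obtain ⟨h1, h2⟩ := ih (by omega) b hb
    have h3 := a.weight_le w fun x y h => (hadj x y h).2
    have h5 := a.le_weight w fun x y h => (hadj x y h).1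
    rw [ha] at h3 h5
    push_cast at h3 h5 ⊢
    obtain ⟨t1, t2⟩ := circularCompleteGraph_adj_emod hd (hc (k + 1) hk u v p hp)
    refine dvd_squeeze (by omega) (by omega) (by linarith) (by linarith) t1 t2 ?_
    have := dvd_sub (p.dvd_sub_weight_emod (fun x => (c x : ℤ)) n)
      (Int.dvd_self_sub_emod (x := (c v : ℤ) - c u) (m := n))
    refine this.trans (dvd_of_eq ?_)
    simp only [hw]
    ring

theorem nonempty_hom_circularCompleteGraph {V : Type*} {G : SimpleGraph V} {n d r : ℕ}
    (hd : 0 < d) (hnd : 2 * d < n) (h4 : n < 4 * d) (c : V → Fin n)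
    (hc : ∀ k ≤ r, ∀ u v (p : G.Walk u v), p.length = 2 * k + 1 →
      (circularCompleteGraph n d).Adj (c u) (c v)) :
    Nonempty (G →g circularCompleteGraph ((2 * r + 1) * n) (r * n + d)) := by
  set w : V → V → ℤ := fun x y => ((c y : ℤ) - c x) % n with hw
  have hadj : ∀ x y, G.Adj x y → (d : ℤ) ≤ w x y ∧ w x y ≤ n - d := fun x y h =>
    circularCompleteGraph_adj_emod hd (hc 0 (Nat.zero_le _) x y (.cons h .nil) rfl)
  set q : ℕ := 2 * r + 1 with hq
  set M : ℤ := r * n + (n - d) with hM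
  have hM0 : 0 ≤ M := by
    have : (0 : ℤ) ≤ r * n := by positivity
    omega
  -- Longest-walk potential: prepending an edge to a walk gives the inequality `hstep`.
  let S : V → Set ℤ := fun u => {x | ∃ v, ∃ p : G.Walk u v, x = q * p.weight w - p.length * M}
  let H : V → ℤ := fun u => sSup (S u)
  have hS : ∀ u, BddAbove (S u) := by
    refine fun u => ⟨q * (q * ((n : ℤ) - d)), ?_⟩
    rintro _ ⟨v, p, rfl⟩
    exact SimpleGraph.Walk.weight_excess_le w (by omega) (by omega) hM0
      (fun x y h => (hadj x y h).2)
      (fun x y p hp => (weight_mem_of_odd_walk hd (by omega) h4 c hc le_rfl p hp).2) p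
  have hstep : ∀ u v, G.Adj u v → H v + q * w u v - M ≤ H u := by
    intro u v h
    have : H v ≤ H u - q * w u v + M := by
      refine csSup_le ⟨_, v, .nil, rfl⟩ ?_
      rintro _ ⟨z, p, rfl⟩
      have := le_csSup (hS u) ⟨z, .cons h p, rfl⟩
      simp only [SimpleGraph.Walk.weight, SimpleGraph.Walk.length_cons] at this
      push_cast at this
      have e : H u = sSup (S u) := rfl
      rw [e]
      linarith
    linarith
  have hN : (0 : ℤ) < (q * n : ℕ) := by
    have : 0 < q * n := Nat.mul_pos (by omega) (by omega)
    omega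
  let F : V → ℤ := fun u => q * (c u : ℤ) + H u
  refine ⟨⟨fun u => ⟨(F u % (q * n : ℕ)).toNat, ?_⟩, ?_⟩⟩
  · have := Int.emod_nonneg (F u) hN.ne'
    have := Int.emod_lt_of_pos (F u) hN
    omega
  · intro u v h
    have h1 := hstep u v h
    have h2 := hstep v u h.symm
    -- The sum of the two lifts is a multiple of `n` strictly between `0` and `2 * n`.
    have hsym : w v u = n - w u v := by
      have b1 := hadj u v h
      have b2 := hadj v u h.symm
      have e1 := Int.emod_add_mul_ediv ((c v : ℤ) - c u) n
      have e2 := Int.emod_add_mul_ediv ((c u : ℤ) - c v) n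
      set a := ((c v : ℤ) - c u) / n
      set b := ((c u : ℤ) - c v) / n
      change w u v + _ = _ at e1
      change w v u + _ = _ at e2
      have e3 : w u v + w v u = n * (-(a + b)) := by linarith
      have l1 : (0 : ℤ) < -(a + b) := by
        refine lt_of_mul_lt_mul_left (a := (n : ℤ)) ?_ (by omega)
        rw [← e3]; omega
      have l2 : -(a + b) < (2 : ℤ) := by
        refine lt_of_mul_lt_mul_left (a := (n : ℤ)) ?_ (by omega)
        rw [← e3]; omega
      rw [show -(a + b) = 1 by omega] at e3
      omega
    rw [hsym] at h2
    have hqn : (q : ℤ) = 2 * r + 1 := by push_cast [hq]; ring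
    -- `hstep` along `u v` bounds this by `M`, which is $qn-(rn+d)$; along `v u` it gives at least
    -- $qn-M = rn+d$.
    refine circularCompleteGraph_adj_of_dvd (by omega) (t := q * w u v + H v - H u) ?_ ?_ ?_
    · push_cast [hM] at h1 h2 ⊢
      rw [hqn] at h2 ⊢
      linarith
    · push_cast [hM] at h1 h2 ⊢
      rw [hqn] at h1 ⊢
      linarith
    · simp only [Int.toNat_of_nonneg (Int.emod_nonneg _ hN.ne')]
      have d1 := Int.dvd_self_sub_emod (x := F u) (m := (q * n : ℕ))
      have d2 := Int.dvd_self_sub_emod (x := F v) (m := (q * n : ℕ))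
      have d3 : ((q * n : ℕ) : ℤ) ∣ q * ((c v : ℤ) - c u) - q * w u v := by
        rw [← mul_sub]
        push_cast
        exact mul_dvd_mul_left _ Int.dvd_self_sub_emod
      have := dvd_add (dvd_sub d1 d2) d3
      refine this.trans (dvd_of_eq ?_)
      simp only [F]
      ring

theorem mainTheorem7 (n d r : ℕ) (hd : 0 < d) (hnd : 2 * d < n) (h4 : (n : ℚ) / (d : ℚ) < 4) :
    HomEquivalent (dualRoot (circularCompleteGraph n d) r)
      (circularCompleteGraph ((2 * r + 1) * n) (r * n + d)) := by
  have h4' : n < 4 * d := by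
    rw [div_lt_iff₀ (by exact_mod_cast hd)] at h4
    exact_mod_cast h4
  refine ⟨nonempty_hom_circularCompleteGraph hd hnd h4' DualRootVertex.root
    fun k hk _ _ p hp => DualRootVertex.root_adj_of_walk hk p hp, ?_⟩
  refine nonempty_hom_dualRoot (fun x => ?_)
    (fun x => ⟨x / (2 * r + 1), Nat.div_lt_of_lt_mul x.2⟩)
    fun k hk _ _ p hp => circularCompleteGraph_adj_div_of_walk hd hnd hk p hp rfl rfl
  have hN : 0 < (2 * r + 1) * n := Nat.mul_pos (by omega) (by omega)
  refine ⟨⟨(x + (r * n + d)) % ((2 * r + 1) * n), Nat.mod_lt _ hN⟩,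
    circularCompleteGraph_adj_of_dvd (by omega) (t := (r * n + d : ℕ)) le_rfl ?_ ?_⟩
  · push_cast
    nlinarith
  · have := Int.dvd_self_sub_emod (x := (x : ℤ) + (r * n + d : ℕ)) (m := ((2 * r + 1) * n : ℕ))
    rw [← dvd_neg] at this
    refine this.trans (dvd_of_eq ?_)
    push_cast
    ring
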